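/- Let $p$ be a prime, let $V$ be an elementary abelian $p$-group of order $p^n$, and let $H$ be a finite group of order not divisible by $p$ acting faithfully on $V$ by automorphisms. Let $G=H\ltimes V$ be the semidirect product, and regard $V$ as an $\mathbb{F}_p[H]$-module. For a positive integer $d$, a finite group $X$ is called a nontrivial $\mathcal{C}_{p^d}$-group if $p^d$ divides $|X|$ and every subgroup $A$ of $X$ of order $p^d$ has a complement in $X$, that is, a subgroup $K$ with $X=AK$ and $A\cap K=1$. Then for every integer $d$ with $0<d<n$, the group $G$ is a nontrivial $\mathcal{C}_{p^d}$-group if and only if at least one of the following holds: (1) $G$ is supersolvable, i.e. $G$ has a finite series $1=N_0\le N_1\le\dots\le N_k=G$ of normal subgroups of $G$ with all factors $N_{i+1}/N_i$ cyclic; (2) $H$ is cyclic, and $V$ is a homogeneous $\mathbb{F}_p[H]$-module (completely reducible with all irreducible submodules isomorphic) all of whose irreducible submodules have $\mathbb{F}_p$-dimension $e$ for some integer $e>1$ with $e\mid\gcd(d,n)$. -/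

import Mathlib

open scoped MonoidAlgebra

open scoped Pointwise in
/-- `G` is a `C_{p^d}`-group: every subgroup `X` of `G` of order `p ^ d` has a complement in `G`,
i.e. a subgroup `K` with `G = X K` and `X ∩ K = 1`. -/
def IsCGroup (p d : ℕ) (G : Type*) [Group G] : Prop :=
  ∀ X : Subgroup G, Nat.card X = p ^ d →
    ∃ K : Subgroup G, (X : Set G) * (K : Set G) = Set.univ ∧ X ⊓ K = ⊥

/-- `G` is a nontrivial `C_{p^d}`-group: a `C_{p^d}`-group such that `p ^ d` is at most the
`p`-part of the order of `G`. -/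
def IsNontrivialCGroup (p d : ℕ) (G : Type*) [Group G] : Prop :=
  IsCGroup p d G ∧ p ^ d ≤ p ^ (Nat.card G).factorization p

/-- `G` is supersolvable: there is a finite series `1 = N 0 ≤ N 1 ≤ ⋯ ≤ N k = G` of normal
subgroups of `G` all of whose factors `N (i + 1) / N i` are cyclic. -/
def IsSupersolvable (G : Type*) [Group G] : Prop :=
  ∃ (k : ℕ) (N : ℕ → Subgroup G) (_ : ∀ i, (N i).Normal),
    N 0 = ⊥ ∧ N k = ⊤ ∧ (∀ i < k, N i ≤ N (i + 1)) ∧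
      ∀ i < k, IsCyclic ((N (i + 1)).map (QuotientGroup.mk' (N i)))

/-- An elementary abelian `p`-group, written additively, as an `𝔽_p`-vector space. -/
@[irreducible] def elemAbModule {p : ℕ} {V : Type*} [CommGroup V] (hV : ∀ v : V, v ^ p = 1) :
    Module (ZMod p) (Additive V) :=
  AddCommGroup.zmodModule (n := p) (fun x : Additive V => hV x.toMul)

/-- The `𝔽_p`-representation of `H` on the elementary abelian `p`-group `V` afforded by an action
of `H` on `V` by automorphisms. -/
def elemAbRep {p : ℕ} {H V : Type*} [Group H] [CommGroup V] [Module (ZMod p) (Additive V)]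
    (φ : H →* MulAut V) : Representation (ZMod p) H (Additive V) where
  toFun h := (MonoidHom.toAdditive (φ h).toMonoidHom).toZModLinearMap p
  map_one' := by ext x; simp
  map_mul' a b := by ext x; simp

/-- The `k[H]`-module afforded by the representation `ρ` is homogeneous (completely reducible, with
all its irreducible submodules isomorphic to each other) and all its irreducible submodules have
dimension `e` over `k`. -/
def IsHomogeneousOfDim {k H V : Type*} [Field k] [Group H] [AddCommGroup V] [Module k V]
    (ρ : Representation k H V) (e : ℕ) : Prop :=
  IsSemisimpleModule k[H] ρ.asModule ∧ IsIsotypic k[H] ρ.asModule ∧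
    ∀ W : Submodule k[H] ρ.asModule, IsSimpleModule k[H] W → Module.finrank k W = e

/-! Since `p` does not divide the order of `H`, a subgroup `X` of order `p ^ d` lies in `V`. A
complement `K` of `X` in `G` meets `V` in an `H`-invariant complement of `X`, and conversely an
invariant complement `W` gives `K = W ⋊ H`. So the theorem concerns modules in which every
`d`-dimensional subspace has an invariant complement (`HasInvariantComplements`); `V` is semisimple
by Maschke.

Necessity: by modularity `d` cannot lie strictly between the dimensions of two consecutive
submodules (`HasInvariantComplements.eq_of_covBy`), so all simple submodules have the same dimension
`e`, and `e` divides `d`. If `e = 1`, then `H` acts diagonalizably, hence is abelian, and `G` is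
supersolvable. If `e > 1`, complements of suitably chosen subspaces are graphs of homomorphisms;
this makes all simple submodules isomorphic and `End S` transitive on nonzero vectors of a simple
`S`. By Wedderburn `End S` is a field, and `H` embeds in its unit group.

Sufficiency: enlarge an invariant `W` disjoint from `X` until `X + W = V`. For `e = 1` add an
invariant line outside `X + W`. In the homogeneous case with `H` cyclic, the group algebra acts on
`V` through a field, and counting finds a vector whose cyclic submodule can be added. -/

section SubspaceDimension

variable {k V : Type*} [Field k] [AddCommGroup V] [Module k V] [FiniteDimensional k V]

open Module

theorem Submodule.finrank_sup_of_disjoint {X Y : Submodule k V} (h : Disjoint X Y) :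
    finrank k (X ⊔ Y : Submodule k V) = finrank k X + finrank k Y := by
  have := Submodule.finrank_sup_add_finrank_inf_eq X Y
  rw [h.eq_bot, finrank_bot] at this
  exact this

theorem Submodule.exists_finrank_eq_between {X Y : Submodule k V} (hXY : X ≤ Y) {d : ℕ}
    (h₁ : finrank k X ≤ d) (h₂ : d ≤ finrank k Y) :
    ∃ Z : Submodule k V, X ≤ Z ∧ Z ≤ Y ∧ finrank k Z = d := by
  induction d, h₁ using Nat.le_induction with
  | base => exact ⟨X, le_rfl, hXY, rfl⟩
  | succ m hm ih =>
    obtain ⟨Z, hXZ, hZY, hZ⟩ := ih (by omega)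
    obtain ⟨v, hvY, hvZ⟩ : ∃ v ∈ Y, v ∉ Z := by
      by_contra! hc
      have := Submodule.finrank_mono (show Y ≤ Z from hc)
      omega
    have hv : v ≠ 0 := fun h => hvZ (h ▸ Z.zero_mem)
    refine ⟨Z ⊔ span k {v}, hXZ.trans le_sup_left,
      sup_le hZY ((span_singleton_le_iff_mem _ _).2 hvY), ?_⟩
    have hd : Disjoint Z (span k {v}) := (Submodule.disjoint_span_singleton' hv).2 hvZ
    rw [Submodule.finrank_sup_of_disjoint hd, hZ, finrank_span_singleton hv]

end SubspaceDimension

/-! ### Invariant complements and the submodule lattice -/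

section InvariantComplements

variable (k A : Type*) {V : Type*} [Field k] [Ring A] [Algebra k A] [AddCommGroup V] [Module k V]
  [Module A V] [IsScalarTower k A V]

open Module

/-- Every `k`-subspace of dimension `d` of the `A`-module `V` has a complement that is an
`A`-submodule. -/
def HasInvariantComplements (V : Type*) [AddCommGroup V] [Module k V] [Module A V]
    [IsScalarTower k A V] (d : ℕ) : Prop :=
  ∀ X : Submodule k V, finrank k X = d →
    ∃ W : Submodule A V, IsCompl X (W.restrictScalars k)

variable {A}

theorem Submodule.restrictScalars_sup_eq (S T : Submodule A V) :
    (S ⊔ T).restrictScalars k = S.restrictScalars k ⊔ T.restrictScalars k := by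
  ext x
  simp only [Submodule.restrictScalars_mem, Submodule.mem_sup]

variable {k}

theorem Submodule.disjoint_restrictScalars {S T : Submodule A V} :
    Disjoint (S.restrictScalars k) (T.restrictScalars k) ↔ Disjoint S T := by
  rw [Submodule.disjoint_def, Submodule.disjoint_def]
  rfl

variable (k)

theorem Submodule.finrank_restrictScalars_sup [FiniteDimensional k V] {S T : Submodule A V}
    (h : Disjoint S T) : finrank k (S ⊔ T : Submodule A V) = finrank k S + finrank k T := by
  have := Submodule.finrank_sup_of_disjoint (Submodule.disjoint_restrictScalars (k := k).2 h)
  rw [← Submodule.restrictScalars_sup_eq] at this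
  exact this

theorem Submodule.finrank_pos_of_isSimpleModule [FiniteDimensional k V] (S : Submodule A V)
    [IsSimpleModule A S] : 0 < finrank k S := by
  have := IsSimpleModule.nontrivial A S
  have : Nontrivial (S.restrictScalars k) := this
  exact finrank_pos (R := k) (M := S.restrictScalars k)

variable {k}

/-- Take `X` of dimension `d` between `S` and `T`, with invariant complement `W`. Then `S ⊔ W ⊓ T`
is `S` or `T`; modularity turns these cases into `X = T` and `X = S`. -/
theorem HasInvariantComplements.eq_of_covBy [FiniteDimensional k V] {d : ℕ}
    (h : HasInvariantComplements k A V d) {S T : Submodule A V} (hST : S ⋖ T)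
    (hS : finrank k S ≤ d) (hT : d ≤ finrank k T) : d = finrank k S ∨ d = finrank k T := by
  obtain ⟨X, hSX, hXT, hX⟩ := Submodule.exists_finrank_eq_between
    (X := S.restrictScalars k) (Y := T.restrictScalars k) hST.le hS hT
  obtain ⟨W, hW⟩ := h X hX
  rcases hST.eq_or_eq (c := S ⊔ W ⊓ T) le_sup_left (sup_le hST.le inf_le_right) with h1 | h1
  · right
    rw [← hX]
    have hle : T.restrictScalars k ≤ X := by
      intro t ht
      obtain ⟨x, hx, w, hw, rfl⟩ := Submodule.mem_sup.1
        (hW.sup_eq_top ▸ Submodule.mem_top : t ∈ X ⊔ W.restrictScalars k)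
      have hwT : w ∈ T := by
        have := T.sub_mem ht (hXT hx)
        rwa [add_sub_cancel_left] at this
      have : w ∈ S := h1 ▸ Submodule.mem_sup_right (show w ∈ W ⊓ T from ⟨hw, hwT⟩)
      exact X.add_mem hx (hSX this)
    exact congrArg (fun Y : Submodule k V => finrank k Y) (le_antisymm hXT hle)
  · left
    rw [← hX]
    have hle : X ≤ S.restrictScalars k := by
      intro x hx
      have hxT : x ∈ S ⊔ W ⊓ T := by rw [h1]; exact hXT hx
      obtain ⟨s, hs, w, hw, rfl⟩ := Submodule.mem_sup.1 hxT
      have hwX : w ∈ X := by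
        have := X.sub_mem hx (hSX hs)
        rwa [add_sub_cancel_left] at this
      have : w = 0 := (Submodule.disjoint_def.1 hW.disjoint) w hwX hw.1
      rw [this, add_zero]
      exact hs
    exact congrArg (fun Y : Submodule k V => finrank k Y) (le_antisymm hle hSX)

theorem Submodule.covBy_sup_of_isSimpleModule {B S : Submodule A V} [IsSimpleModule A S]
    (h : Disjoint B S) : B ⋖ B ⊔ S := by
  apply covBy_sup_of_inf_covBy_right
  rw [h.eq_bot, bot_covBy_iff]
  exact isSimpleModule_iff_isAtom.1 inferInstance

/-- `P` is only an additive subgroup, so that it can be a `k`-subspace or the fixed points of one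
group element, neither of which need be an `A`-submodule. -/
theorem Submodule.mem_of_forall_isSimpleModule [IsSemisimpleModule A V] (P : AddSubgroup V)
    (hP : ∀ S : Submodule A V, IsSimpleModule A S → ∀ x ∈ S, x ∈ P) (v : V) : v ∈ P := by
  have hv : v ∈ sSup {m : Submodule A V | IsSimpleModule A m} := by
    rw [IsSemisimpleModule.sSup_simples_eq_top]; trivial
  rw [sSup_eq_iSup'] at hv
  induction hv using Submodule.iSup_induction' with
  | mem i x hx => exact hP i i.2 x hx
  | zero => exact P.zero_mem
  | add x y _ _ hx hy => exact P.add_mem hx hy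

theorem Submodule.exists_isSimpleModule_disjoint [IsSemisimpleModule A V] {B : Submodule A V}
    (hB : B ≠ ⊤) : ∃ S : Submodule A V, IsSimpleModule A S ∧ Disjoint B S := by
  by_contra! hc
  refine hB (eq_top_iff.2 fun v _ =>
    Submodule.mem_of_forall_isSimpleModule (A := A) B.toAddSubgroup (fun S hS x hx => ?_) v)
  have hat : IsAtom S := isSimpleModule_iff_isAtom.1 hS
  have := hat.not_disjoint_iff_le.1 (fun h => hc S hS h.symm)
  exact this hx

/-- Take `B` of maximal dimension among submodules disjoint from `S ⊔ T` with `dim B + dim S ≤ d`. A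
further simple summand carries `B ⊔ S` past dimension `d`, so the covering lemma forces equality.
This `B` pads an `e`-dimensional test subspace of `S ⊔ T` to dimension `d`. -/
theorem HasInvariantComplements.exists_disjoint_finrank [FiniteDimensional k V]
    [IsSemisimpleModule A V] {d : ℕ} (h : HasInvariantComplements k A V d) (hd : 0 < d)
    (hdn : d < finrank k V) (S T : Submodule A V) [IsSimpleModule A S] [IsSimpleModule A T]
    (hST : Disjoint S T) :
    ∃ B : Submodule A V, Disjoint B (S ⊔ T) ∧ finrank k B + finrank k S = d := by
  have hS := Submodule.finrank_pos_of_isSimpleModule k S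
  have hSd : finrank k S ≤ d := by
    by_contra hlt
    have hc : (⊥ : Submodule A V) ⋖ S :=
      bot_covBy_iff.2 (isSimpleModule_iff_isAtom.1 inferInstance)
    have h0 : finrank k (⊥ : Submodule A V) = 0 := finrank_bot k V
    have := h.eq_of_covBy hc (by omega) (by omega)
    omega
  let P : ℕ → Prop := fun m => ∃ B : Submodule A V,
    Disjoint B (S ⊔ T) ∧ finrank k B + finrank k S ≤ d ∧ finrank k B = m
  have hP : ∃ m, P m :=
    ⟨_, ⊥, disjoint_bot_left, by rwa [show finrank k (⊥ : Submodule A V) = 0 from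
      finrank_bot k V, zero_add], rfl⟩
  classical
  obtain ⟨m, ⟨B, hB, hBd, rfl⟩, hmax⟩ : ∃ m, P m ∧ ∀ m', P m' → m' ≤ m := by
    have hbd : ∀ m, P m → m ≤ d := by
      rintro m ⟨B, -, hB, rfl⟩; omega
    obtain ⟨m, hm⟩ := hP
    exact ⟨Nat.findGreatest P d, Nat.findGreatest_spec (hbd m hm) hm,
      fun m' hm' => Nat.le_findGreatest (hbd m' hm') hm'⟩
  refine ⟨B, hB, ?_⟩
  have hBS : finrank k (B ⊔ S : Submodule A V) = finrank k B + finrank k S :=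
    Submodule.finrank_restrictScalars_sup k (hB.mono_right le_sup_left)
  have key : ∀ R : Submodule A V, IsSimpleModule A R → Disjoint (B ⊔ S) R →
      d < finrank k B + finrank k S + finrank k R → finrank k B + finrank k S = d := by
    intro R hR hdis hlt
    have hc := Submodule.covBy_sup_of_isSimpleModule hdis
    have hf := Submodule.finrank_restrictScalars_sup k hdis
    have := h.eq_of_covBy hc (by omega) (by omega)
    omega
  -- If nothing is left outside `B ⊔ S ⊔ T`, then `T` itself is the extra summand, and it overshoots
  -- because `d < dim V`.
  by_cases htop : B ⊔ (S ⊔ T) = ⊤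
  · have hBST : Disjoint (B ⊔ S) T := hST.disjoint_sup_left_of_disjoint_sup_right hB
    refine key T inferInstance hBST ?_
    have hf := Submodule.finrank_restrictScalars_sup k hBST
    rw [sup_assoc, htop] at hf
    have : finrank k (⊤ : Submodule A V) = finrank k V := finrank_top k V
    omega
  · obtain ⟨R, hR, hdis⟩ := Submodule.exists_isSimpleModule_disjoint htop
    refine key R hR (hdis.mono_left (sup_le_sup_left le_sup_left B)) ?_
    by_contra hle
    have hBR : Disjoint (B ⊔ R) (S ⊔ T) := by
      refine (hdis.mono_left le_sup_right).symm.disjoint_sup_left_of_disjoint_sup_right ?_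
      rw [sup_comm R]
      exact hB.disjoint_sup_right_of_disjoint_sup_left hdis
    have hf := Submodule.finrank_restrictScalars_sup k
      (hdis.mono_left le_sup_left : Disjoint B R)
    have hRp := Submodule.finrank_pos_of_isSimpleModule k R
    have := hmax _ ⟨B ⊔ R, hBR, by omega, rfl⟩
    omega

theorem hasInvariantComplements_of_forall_exists_lt [FiniteDimensional k V] {d : ℕ}
    (hext : ∀ X : Submodule k V, finrank k X = d → ∀ W : Submodule A V,
      Disjoint X (W.restrictScalars k) → X ⊔ W.restrictScalars k ≠ ⊤ →
        ∃ W' : Submodule A V, W < W' ∧ Disjoint X (W'.restrictScalars k)) :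
    HasInvariantComplements k A V d := by
  intro X hX
  have : IsNoetherian A V := isNoetherian_of_tower k inferInstance
  obtain ⟨W, hW, hmax⟩ := (wellFounded_gt (α := Submodule A V)).has_min
    {W | Disjoint X (W.restrictScalars k)} ⟨⊥, by
      rw [Set.mem_ofPred_eq, Submodule.restrictScalars_bot]; exact disjoint_bot_right⟩
  refine ⟨W, hW, codisjoint_iff.2 ?_⟩
  by_contra hne
  obtain ⟨W', hlt, hdis⟩ := hext X hX W hW hne
  exact hmax W' hdis hlt

end InvariantComplements

/-! ### Necessity: equal dimensions, isomorphic simple submodules, cyclicity -/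

section SemisimpleModule

open Module

variable {k A V : Type*} [Field k] [Ring A] [Algebra k A] [AddCommGroup V] [Module k V]
  [Module A V] [IsScalarTower k A V] [FiniteDimensional k V] [IsSemisimpleModule A V]

theorem HasInvariantComplements.finrank_le {d : ℕ} (h : HasInvariantComplements k A V d)
    (hd : 0 < d) (hdn : d < finrank k V) (S T : Submodule A V) [IsSimpleModule A S]
    [IsSimpleModule A T] (hST : Disjoint S T) : finrank k T ≤ finrank k S := by
  obtain ⟨B, hB, hBd⟩ := h.exists_disjoint_finrank hd hdn S T hST
  have hS := Submodule.finrank_pos_of_isSimpleModule k S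
  by_contra hlt
  have hdis : Disjoint B T := hB.mono_right le_sup_right
  have hf := Submodule.finrank_restrictScalars_sup k hdis
  have := h.eq_of_covBy (Submodule.covBy_sup_of_isSimpleModule hdis) (by omega) (by omega)
  omega

theorem Submodule.eq_or_disjoint_of_isSimpleModule {A V : Type*} [Ring A] [AddCommGroup V]
    [Module A V] (S T : Submodule A V) [IsSimpleModule A S] [IsSimpleModule A T] :
    S = T ∨ Disjoint S T := by
  have hS : IsAtom S := isSimpleModule_iff_isAtom.1 inferInstance
  have hT : IsAtom T := isSimpleModule_iff_isAtom.1 inferInstance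
  by_cases hST : Disjoint S T
  · exact Or.inr hST
  · exact Or.inl (le_antisymm (hS.not_disjoint_iff_le.1 hST)
      (hT.not_disjoint_iff_le.1 fun h => hST h.symm))

theorem HasInvariantComplements.finrank_eq {d : ℕ} (h : HasInvariantComplements k A V d)
    (hd : 0 < d) (hdn : d < finrank k V) (S T : Submodule A V) [IsSimpleModule A S]
    [IsSimpleModule A T] : finrank k S = finrank k T := by
  rcases Submodule.eq_or_disjoint_of_isSimpleModule S T with rfl | hST
  · rfl
  · exact le_antisymm (h.finrank_le hd hdn T S hST.symm) (h.finrank_le hd hdn S T hST)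

/-- If all simple submodules of a semisimple module have dimension `e`, then `e` divides the
dimension of every submodule. -/
theorem Submodule.dvd_finrank_of_forall_isSimpleModule {e : ℕ}
    (he : ∀ S : Submodule A V, IsSimpleModule A S → finrank k S = e) (W : Submodule A V) :
    e ∣ finrank k W := by
  induction hm : finrank k W using Nat.strong_induction_on generalizing W with
  | _ m ih =>
  subst hm
  rcases IsSemisimpleModule.eq_bot_or_exists_simple_le W with hW | ⟨S, hSW, hS⟩
  · rw [hW, show finrank k (⊥ : Submodule A V) = 0 from finrank_bot k V]
    exact dvd_zero e
  · obtain ⟨C, hC, rfl⟩ := IsModularLattice.exists_disjoint_and_sup_eq hSW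
    have hf := Submodule.finrank_restrictScalars_sup k hC
    have hp := Submodule.finrank_pos_of_isSimpleModule k S
    rw [hf, he S hS]
    exact (Nat.dvd_add_right (dvd_refl e)).2 (ih _ (by omega) C rfl)

/-- Otherwise the values `f s` lie in a hyperplane `Y` of `T`. An invariant complement of `B ⊕ ⟨s⟩ ⊕
Y` cuts out in `S ⊕ T` a submodule `Q` complementary to `T`, that is, a graph; projecting along it
gives a homomorphism whose value at `s` lies in `Y`, which puts `s` in `T`. -/
theorem HasInvariantComplements.exists_linearMap_apply_eq {d : ℕ}
    (h : HasInvariantComplements k A V d) (hd : 0 < d) (hdn : d < finrank k V)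
    (S T : Submodule A V) [IsSimpleModule A S] [IsSimpleModule A T] (hST : Disjoint S T)
    (hS : 1 < finrank k S) (s : S) (hs : s ≠ 0) (t : T) : ∃ f : S →ₗ[A] T, f s = t := by
  obtain ⟨B, hB, hBd⟩ := h.exists_disjoint_finrank hd hdn S T hST
  have hTS : finrank k S = finrank k T := h.finrank_eq hd hdn S T
  by_contra! hne
  let Y₀ : Submodule k T :=
    { carrier := Set.range fun f : S →ₗ[A] T => f s
      add_mem' := by
        rintro _ _ ⟨f, rfl⟩ ⟨g, rfl⟩
        exact ⟨f + g, rfl⟩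
      zero_mem' := ⟨0, rfl⟩
      smul_mem' := by
        rintro c _ ⟨f, rfl⟩
        exact ⟨c • f, rfl⟩ }
  have hY₀ : Y₀ < ⊤ := by
    refine lt_top_iff_ne_top.2 fun hc => ?_
    obtain ⟨f, hf⟩ : t ∈ Y₀ := hc ▸ Submodule.mem_top
    exact hne f hf
  have : FiniteDimensional k T :=
    inferInstanceAs (FiniteDimensional k (T.restrictScalars k))
  have hY₀lt := Submodule.finrank_lt hY₀.ne
  obtain ⟨Y₁, hY₀₁, -, hY₁⟩ := Submodule.exists_finrank_eq_between (X := Y₀) (Y := ⊤) le_top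
    (d := finrank k T - 1) (by omega) (by rw [finrank_top]; omega)
  let ι : T →ₗ[k] V := T.subtype.restrictScalars k
  have hι : Function.Injective ι := Subtype.val_injective
  let Y : Submodule k V := Y₁.map ι
  have hY : finrank k Y = finrank k T - 1 := by
    rw [← hY₁]; exact (Submodule.equivMapOfInjective ι hι Y₁).finrank_eq.symm
  have hYT : Y ≤ T.restrictScalars k := by
    rintro _ ⟨y, -, rfl⟩; exact y.2
  have hs0 : (s : V) ≠ 0 := fun h0 => hs (Subtype.ext h0)
  let Z : Submodule k V := Submodule.span k {(s : V)} ⊔ Y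
  have hZST : Z ≤ (S ⊔ T).restrictScalars k := by
    refine sup_le ((Submodule.span_singleton_le_iff_mem _ _).2 ?_)
      (hYT.trans fun x hx => Submodule.mem_sup_right hx)
    exact Submodule.mem_sup_left s.2
  have hsY : Disjoint (Submodule.span k {(s : V)}) Y := by
    refine ((Submodule.disjoint_restrictScalars (k := k)).2 hST).mono ?_ hYT
    exact (Submodule.span_singleton_le_iff_mem _ _).2 s.2
  have hZ : finrank k Z = finrank k T := by
    rw [Submodule.finrank_sup_of_disjoint hsY, hY, finrank_span_singleton hs0]
    omega
  have hBZ : Disjoint (B.restrictScalars k) Z :=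
    ((Submodule.disjoint_restrictScalars (k := k)).2 hB).mono_right hZST
  obtain ⟨W, hW⟩ := h (B.restrictScalars k ⊔ Z) (by
    rw [Submodule.finrank_sup_of_disjoint hBZ, hZ, ← hTS]; exact hBd)
  have hWn : d + finrank k W = finrank k V := by
    have := Submodule.finrank_add_eq_of_isCompl hW
    rw [Submodule.finrank_sup_of_disjoint hBZ, hZ, ← hTS] at this
    have h2 : finrank k (B.restrictScalars k) = finrank k B := rfl
    have h3 : finrank k (W.restrictScalars k) = finrank k W := rfl
    omega
  have hBW : Disjoint B W :=
    Submodule.disjoint_restrictScalars.1 (hW.disjoint.mono_left le_sup_left)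
  let Q : Submodule A V := (B ⊔ W) ⊓ (S ⊔ T)
  have hQZ : Disjoint (Q.restrictScalars k) Z := by
    rw [Submodule.disjoint_def]
    rintro q ⟨hq₁, hq₂⟩ hqZ
    obtain ⟨b, hb, w, hw, rfl⟩ := Submodule.mem_sup.1 hq₁
    have hwX : w ∈ B.restrictScalars k ⊔ Z := by
      have := (B.restrictScalars k ⊔ Z).sub_mem (Submodule.mem_sup_right hqZ)
        (Submodule.mem_sup_left (show b ∈ B.restrictScalars k from hb))
      rwa [add_sub_cancel_left] at this
    have hw0 : w = 0 := Submodule.disjoint_def.1 hW.disjoint w hwX hw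
    rw [hw0, add_zero] at hq₂ ⊢
    exact Submodule.disjoint_def.1 hB b hb hq₂
  -- `B ⊔ W` has codimension `dim S` in `V`, so it meets `S ⊔ T` in dimension at least `dim T`.
  have hQ : finrank k T ≤ finrank k Q := by
    have h1 := Submodule.finrank_sup_add_finrank_inf_eq
      ((B ⊔ W).restrictScalars k) ((S ⊔ T).restrictScalars k)
    have h2 := Submodule.finrank_le ((B ⊔ W).restrictScalars k ⊔ (S ⊔ T).restrictScalars k)
    have h3 : finrank k ((B ⊔ W).restrictScalars k) = finrank k B + finrank k W :=
      Submodule.finrank_restrictScalars_sup k hBW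
    have h4 : finrank k ((S ⊔ T).restrictScalars k) = finrank k S + finrank k T :=
      Submodule.finrank_restrictScalars_sup k hST
    have h5 : finrank k ((B ⊔ W).restrictScalars k ⊓ (S ⊔ T).restrictScalars k : Submodule k V) =
      finrank k Q := rfl
    omega
  -- Here `e > 1` is essential: it makes `Y` nonzero, so `T`, which contains `Y`, cannot lie in `Q`.
  have hQT : Disjoint Q T := by
    have hat : IsAtom T := isSimpleModule_iff_isAtom.1 inferInstance
    by_contra hc
    have hTQ : T ≤ Q := hat.not_disjoint_iff_le.1 fun h => hc h.symm
    have hY0 : Y = ⊥ := by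
      refine (Submodule.eq_bot_iff Y).2 fun y hy => ?_
      exact Submodule.disjoint_def.1 hQZ y (hTQ (hYT hy)) (Submodule.mem_sup_right hy)
    rw [hY0, finrank_bot] at hY
    omega
  have hQTeq : (Q ⊔ T).restrictScalars k = (S ⊔ T).restrictScalars k := by
    refine Submodule.eq_of_le_of_finrank_le 
      (show Q ⊔ T ≤ S ⊔ T from sup_le inf_le_right le_sup_right) ?_
    have h1 : finrank k ((Q ⊔ T).restrictScalars k) = finrank k Q + finrank k T :=
      Submodule.finrank_restrictScalars_sup k hQT
    have h2 : finrank k ((S ⊔ T).restrictScalars k) = finrank k S + finrank k T :=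
      Submodule.finrank_restrictScalars_sup k hST
    omega
  obtain ⟨Q', hQQ', hc⟩ := hQT.exists_isCompl
  have hsQT : (s : V) ∈ Q ⊔ T := by
    have : (s : V) ∈ (S ⊔ T).restrictScalars k := Submodule.mem_sup_left s.2
    rw [← hQTeq] at this
    exact this
  obtain ⟨q, hq, t', ht', hqt⟩ := Submodule.mem_sup.1 hsQT
  let f : S →ₗ[A] T := (Submodule.projectionOnto T Q' hc.symm).comp S.subtype
  have hf : f s = ⟨t', ht'⟩ := by
    change Submodule.projectionOnto T Q' hc.symm (s : V) = _
    rw [← hqt, map_add, Submodule.projectionOnto_apply_eq_zero_iff hc.symm |>.2 (hQQ' hq), zero_add]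
    exact Submodule.projectionOnto_apply_left hc.symm ⟨t', ht'⟩
  have ht'Y : t' ∈ Y := ⟨⟨t', ht'⟩, hY₀₁ ⟨f, hf⟩, rfl⟩
  have hq0 : q = 0 := by
    refine Submodule.disjoint_def.1 hQZ q hq ?_
    have := Z.sub_mem (Submodule.mem_sup_left (Submodule.mem_span_singleton_self (s : V)))
      (Submodule.mem_sup_right ht'Y)
    rwa [← hqt, add_sub_cancel_right] at this
  rw [hq0, zero_add] at hqt
  exact hs0 (Submodule.disjoint_def.1 hST s s.2 (hqt ▸ ht'))

theorem HasInvariantComplements.nonempty_linearEquiv {d : ℕ}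
    (h : HasInvariantComplements k A V d) (hd : 0 < d) (hdn : d < finrank k V)
    (S T : Submodule A V) [IsSimpleModule A S] [IsSimpleModule A T] (hS : 1 < finrank k S) :
    Nonempty (S ≃ₗ[A] T) := by
  rcases Submodule.eq_or_disjoint_of_isSimpleModule S T with rfl | hST
  · exact ⟨LinearEquiv.refl A S⟩
  · have := IsSimpleModule.nontrivial A S
    have := IsSimpleModule.nontrivial A T
    obtain ⟨s, hs⟩ := exists_ne (0 : S)
    obtain ⟨t, ht⟩ := exists_ne (0 : T)
    obtain ⟨f, hf⟩ := h.exists_linearMap_apply_eq hd hdn S T hST hS s hs t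
    have hf0 : f ≠ 0 := by
      rintro rfl
      exact ht hf.symm
    exact ⟨LinearEquiv.ofBijective f (LinearMap.bijective_of_ne_zero hf0)⟩

theorem HasInvariantComplements.exists_disjoint_isSimpleModule {d : ℕ}
    (h : HasInvariantComplements k A V d) (hd : 0 < d) (hdn : d < finrank k V)
    (S : Submodule A V) [IsSimpleModule A S] :
    ∃ T : Submodule A V, IsSimpleModule A T ∧ Disjoint S T := by
  refine Submodule.exists_isSimpleModule_disjoint fun hc => ?_
  have h0 : finrank k (⊥ : Submodule A V) = 0 := finrank_bot k V
  have h1 : finrank k S = finrank k V := by rw [hc]; exact finrank_top k V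
  have := h.eq_of_covBy (bot_covBy_iff.2 (isSimpleModule_iff_isAtom (m := S) |>.1
    inferInstance)) (by omega) (by omega)
  omega

theorem HasInvariantComplements.dvd {d : ℕ}
    (h : HasInvariantComplements k A V d) (hd : 0 < d) (hdn : d < finrank k V)
    (S : Submodule A V) [IsSimpleModule A S] : finrank k S ∣ d := by
  obtain ⟨T, hT, hST⟩ := h.exists_disjoint_isSimpleModule hd hdn S
  obtain ⟨B, -, hB⟩ := h.exists_disjoint_finrank hd hdn S T hST
  rw [← hB]
  exact (Nat.dvd_add_left (dvd_refl _)).2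
    (Submodule.dvd_finrank_of_forall_isSimpleModule (fun R _ => h.finrank_eq hd hdn R S) B)

theorem HasInvariantComplements.exists_end_apply_eq {d : ℕ}
    (h : HasInvariantComplements k A V d) (hd : 0 < d) (hdn : d < finrank k V)
    (S : Submodule A V) [IsSimpleModule A S] (hS : 1 < finrank k S) (s t : S) (hs : s ≠ 0) :
    ∃ f : S →ₗ[A] S, f s = t := by
  obtain ⟨T, hT, hST⟩ := h.exists_disjoint_isSimpleModule hd hdn S
  obtain ⟨g⟩ := h.nonempty_linearEquiv hd hdn S T hS
  obtain ⟨f, hf⟩ := h.exists_linearMap_apply_eq hd hdn S T hST hS s hs (g t)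
  exact ⟨g.symm.toLinearMap.comp f, by simp [hf]⟩

/-- A finite group acting faithfully on a finite simple module through a ring is cyclic, provided
that the endomorphisms of the module act transitively on its nonzero elements. -/
theorem isCyclic_of_forall_exists_end_apply_eq {A M Γ : Type*} [Ring A] [AddCommGroup M]
    [Module A M] [IsSimpleModule A M] [Finite M] [Group Γ] [Finite Γ] (u : Γ →* A)
    (htrans : ∀ s t : M, s ≠ 0 → ∃ f : M →ₗ[A] M, f s = t)
    (hfaith : ∀ g, (∀ m : M, u g • m = m) → g = 1) : IsCyclic Γ := by
  classical
  have hfin : Finite (Module.End A M) :=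
    Finite.of_injective (fun f : Module.End A M => (f : M → M)) DFunLike.coe_injective
  -- Schur makes the endomorphism ring a division ring; being finite, it is commutative.
  have hcomm : ∀ f g : Module.End A M, f * g = g * f := by
    let _ := Module.End.instDivisionRing (R := A) (M := M)
    exact (littleWedderburn (Module.End A M)).mul_comm
  let _ : CommRing (Module.End A M) := { (inferInstance : Ring (Module.End A M)) with
    mul_comm := hcomm }
  have : IsSimpleModule A M := inferInstance
  have hnt := IsSimpleModule.nontrivial A M
  obtain ⟨s, hs⟩ := exists_ne (0 : M)
  have huniq : ∀ f g : M →ₗ[A] M, f s = g s → f = g := by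
    intro f g hfg
    rcases LinearMap.injective_or_eq_zero (f - g) with hi | h0
    · exact absurd (hi (by simp [hfg] : (f - g) s = (f - g) 0)) hs
    · exact sub_eq_zero.1 h0
  have hnz : NoZeroDivisors (Module.End A M) := ⟨by
    intro f g hfg
    rcases LinearMap.injective_or_eq_zero f with hi | h0
    · refine Or.inr (LinearMap.ext fun m => hi ?_)
      rw [← Module.End.mul_apply, hfg]
      simp
    · exact Or.inl h0⟩
  have hd : IsDomain (Module.End A M) := NoZeroDivisors.to_isDomain _
  choose δ hδ using fun g : Γ => htrans s (u g • s) hs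
  let Δ : Γ →* Module.End A M :=
    { toFun := δ
      map_one' := huniq _ _ (by simp [hδ])
      map_mul' := fun g h => by
        -- The relation `δ (g * h) s = δ h (δ g s)` reverses the order, so `δ` is multiplicative
        -- only thanks to commutativity.
        rw [hcomm]
        refine huniq _ _ ?_
        change δ (g * h) s = δ h (δ g s)
        rw [hδ, hδ, map_smul, hδ, map_mul, mul_smul] }
  refine isCyclic_of_injective_ringHom Δ ((injective_iff_map_eq_one Δ).2 fun g hg => ?_)
  have hgs : u g • s = s := by
    rw [← hδ]
    exact congrArg (fun f : Module.End A M => f s) hg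
  refine hfaith g fun m => ?_
  obtain ⟨f, rfl⟩ := htrans s m hs
  rw [← map_smul, hgs]

/-! ### Sufficiency: constructing invariant complements -/

theorem hasInvariantComplements_of_finrank_eq_one
    (h1 : ∀ S : Submodule A V, IsSimpleModule A S → finrank k S = 1) (d : ℕ) :
    HasInvariantComplements k A V d := by
  refine hasInvariantComplements_of_forall_exists_lt fun X _ W hXW hne => ?_
  obtain ⟨S, hS, x, hxS, hx⟩ : ∃ S : Submodule A V, IsSimpleModule A S ∧
      ∃ x ∈ S, x ∉ X ⊔ W.restrictScalars k := by
    by_contra! hc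
    exact hne (eq_top_iff.2 fun v _ => Submodule.mem_of_forall_isSimpleModule (A := A)
      (X ⊔ W.restrictScalars k).toAddSubgroup hc v)
  have hx0 : (⟨x, hxS⟩ : S) ≠ 0 := fun h0 =>
    hx (by rw [show x = 0 from congrArg Subtype.val h0]; exact Submodule.zero_mem _)
  have hdis : Disjoint (X ⊔ W.restrictScalars k) (S.restrictScalars k) := by
    rw [Submodule.disjoint_def]
    intro y hy hyS
    obtain ⟨c, hc⟩ := (finrank_eq_one_iff_of_nonzero' _ hx0).1 (h1 S hS) ⟨y, hyS⟩
    have hcx : c • x = y := congrArg Subtype.val hc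
    by_cases hc0 : c = 0
    · rw [← hcx, hc0, zero_smul]
    · refine absurd ?_ hx
      rw [← hcx] at hy
      exact (Submodule.smul_mem_iff _ hc0).1 hy
  refine ⟨W ⊔ S, lt_of_le_of_ne le_sup_left fun heq => ?_, ?_⟩
  · have : x ∈ W := heq ▸ Submodule.mem_sup_right hxS
    exact hx (Submodule.mem_sup_right this)
  · rw [Submodule.restrictScalars_sup_eq]
    exact hXW.disjoint_sup_right_of_disjoint_sup_left hdis

/-- By commutativity the kernel of `a` is a submodule; if nonzero it contains a simple one, and
every simple submodule is isomorphic to that. -/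
theorem IsIsotypic.smul_eq_zero_of_smul_eq_zero {A V : Type*} [Ring A] [AddCommGroup V]
    [Module A V] [IsSemisimpleModule A V] (hiso : IsIsotypic A V)
    (hcomm : ∀ a b : A, a * b = b * a) {a : A} {x : V} (hx : x ≠ 0) (hax : a • x = 0) (v : V) :
    a • v = 0 := by
  let N : Submodule A V :=
    { carrier := {v | a • v = 0}
      add_mem' := fun {v w} hv hw => by
        rw [Set.mem_ofPred_eq] at *
        rw [smul_add, hv, hw, add_zero]
      zero_mem' := smul_zero a
      smul_mem' := fun b v hv => by
        rw [Set.mem_ofPred_eq] at *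
        rw [smul_smul, hcomm, mul_smul, hv, smul_zero] }
  rcases IsSemisimpleModule.eq_bot_or_exists_simple_le N with hN | ⟨S, hSN, hS⟩
  · exact absurd ((Submodule.eq_bot_iff N).1 hN x hax) hx
  · refine Submodule.mem_of_forall_isSimpleModule (A := A) N.toAddSubgroup
      (fun T hT y hy => ?_) v
    obtain ⟨g⟩ := hiso S T
    have h0 : g (a • ⟨y, hy⟩) = 0 := by
      rw [map_smul]
      exact Subtype.ext (hSN (g ⟨y, hy⟩).2)
    exact congrArg Subtype.val ((map_eq_zero_iff g g.injective).1 h0)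

theorem hasInvariantComplements_of_isIsotypic [Finite k] {d e : ℕ}
    (hcomm : ∀ a b : A, a * b = b * a) (hiso : IsIsotypic A V)
    (he : ∀ S : Submodule A V, IsSimpleModule A S → finrank k S = e) (hed : e ∣ d) :
    HasInvariantComplements k A V d := by
  refine hasInvariantComplements_of_forall_exists_lt fun X hX W hXW hne => ?_
  have hfV : Finite V := Module.finite_of_finite k
  set U := X ⊔ W.restrictScalars k with hU
  have hnt : Nontrivial V := by
    by_contra hc
    rw [not_nontrivial_iff_subsingleton] at hc
    exact hne (eq_top_iff.2 fun v _ => Subsingleton.elim (0 : V) v ▸ U.zero_mem)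
  obtain ⟨S, hS⟩ := IsSemisimpleModule.exists_simple_submodule A V
  have hntS := IsSimpleModule.nontrivial A S
  obtain ⟨s, hs⟩ := exists_ne (0 : S)
  have hsV : (s : V) ≠ 0 := fun h => hs (Subtype.ext h)
  have hfS : Finite S := inferInstance
  -- Both `dim U` and `dim V` are multiples of `e`, so `dim U < dim V` leaves room for a full `e`.
  have hcard : Nat.card S * Nat.card U ≤ Nat.card V := by
    have h1 : e ∣ finrank k V := by
      have := Submodule.dvd_finrank_of_forall_isSimpleModule he (⊤ : Submodule A V)
      rwa [show finrank k (⊤ : Submodule A V) = finrank k V from finrank_top k V] at this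
    have h2 : finrank k U = d + finrank k W := by
      rw [hU, Submodule.finrank_sup_of_disjoint hXW, hX]; rfl
    have h3 : e ∣ finrank k U :=
      h2 ▸ dvd_add hed (Submodule.dvd_finrank_of_forall_isSimpleModule he W)
    have h4 : finrank k U < finrank k V := Submodule.finrank_lt hne
    have h5 : e + finrank k U ≤ finrank k V := by
      have := Nat.le_of_dvd (by omega) (Nat.dvd_sub h1 h3)
      omega
    rw [Module.natCard_eq_pow_finrank (K := k) (V := S),
      Module.natCard_eq_pow_finrank (K := k) (V := U),
      Module.natCard_eq_pow_finrank (K := k) (V := V), ← pow_add, he S hS]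
    exact Nat.pow_le_pow_right Nat.card_pos h5
  obtain ⟨v, hv⟩ : ∃ v : V, ∀ a : A, a • v ∈ U → ∀ x : V, a • x = 0 := by
    by_contra! hc
    choose α hαU x hx using hc
    have hα : ∀ v w : V, w ≠ 0 → α v • w ≠ 0 := fun v w hw h0 =>
      hx v (hiso.smul_eq_zero_of_smul_eq_zero hcomm hw h0 (x v))
    -- If every `v` had an `α v` acting nontrivially with `α v • v ∈ U`, this map would be
    -- injective: `α v • s` determines the action of `α v`, which is injective on `V`. Its target
    -- has fewer than `|S| |U| ≤ |V|` elements.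
    let Φ : V → {s : S // s ≠ 0} × U := fun v =>
      (⟨α v • s, fun h0 => hα v s hsV (congrArg Subtype.val h0)⟩, ⟨α v • v, hαU v⟩)
    have hΦ : Function.Injective Φ := by
      intro v w hvw
      have h1 : α v • s = α w • s := congrArg (fun z => z.1.1) hvw
      have h2 : α v • v = α w • w := congrArg (fun z => (z.2 : V)) hvw
      have h3 : (α v - α w) • (s : V) = 0 := by
        rw [sub_smul, sub_eq_zero]
        exact congrArg Subtype.val h1
      have h4 := hiso.smul_eq_zero_of_smul_eq_zero hcomm hsV h3 w
      rw [sub_smul, sub_eq_zero, ← h2] at h4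
      by_contra hne
      refine hα v (v - w) (sub_ne_zero.2 hne) ?_
      rw [smul_sub, h4, sub_self]
    have h1 := Nat.card_le_card_of_injective Φ hΦ
    rw [Nat.card_prod] at h1
    have h2 : Nat.card {s : S // s ≠ 0} < Nat.card S :=
      Finite.card_subtype_lt (x := (0 : S)) (by simp)
    have h3 : 0 < Nat.card U := Nat.card_pos
    have := Nat.mul_lt_mul_of_pos_right h2 h3
    omega
  refine ⟨W ⊔ Submodule.span A {v}, lt_of_le_of_ne le_sup_left fun heq => ?_, ?_⟩
  · have hvW : v ∈ W := by
      rw [heq]; exact Submodule.mem_sup_right (Submodule.mem_span_singleton_self v)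
    have := hv 1 (by rw [one_smul]; exact Submodule.mem_sup_right hvW) s
    rw [one_smul] at this
    exact hsV this
  · rw [Submodule.disjoint_def]
    intro x hxX hxW
    obtain ⟨w, hw, y, hy, rfl⟩ := Submodule.mem_sup.1
      (show x ∈ W ⊔ Submodule.span A {v} from hxW)
    obtain ⟨a, rfl⟩ := Submodule.mem_span_singleton.1 hy
    have haU : a • v ∈ U := by
      have := U.sub_mem (Submodule.mem_sup_left hxX)
        (Submodule.mem_sup_right (show w ∈ W.restrictScalars k from hw))
      rwa [add_sub_cancel_left] at this
    rw [hv a haU v, add_zero] at hxX ⊢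
    exact Submodule.disjoint_def.1 hXW w hxX hw

end SemisimpleModule

/-! ### From complements in the semidirect product to invariant complements -/

section SemidirectProduct

open Module SemidirectProduct

variable {p d : ℕ} [Fact p.Prime] {H V : Type*} [Group H] [CommGroup V]
  [Module (ZMod p) (Additive V)] (φ : H →* MulAut V)

instance [Finite V] : Finite (elemAbRep (p := p) φ).asModule :=
  inferInstanceAs (Finite (Additive V))

variable (p) in
/-- An element of the elementary abelian group, seen in the associated module. -/
def elemAbVec (v : V) : (elemAbRep (p := p) φ).asModule :=
  show Additive V from Additive.ofMul v

/-- The subgroup of the elementary abelian group underlying a subspace. -/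
def elemAbSubgroup (X : Submodule (ZMod p) (elemAbRep (p := p) φ).asModule) : Subgroup V :=
  AddSubgroup.toSubgroup (show AddSubgroup (Additive V) from X.toAddSubgroup)

/-- The submodule of an elementary abelian group attached to a subgroup invariant under the
action. -/
def invariantSubmodule (N : Subgroup V) (hN : ∀ h, ∀ v ∈ N, φ h v ∈ N) :
    Submodule (ZMod p)[H] (elemAbRep (p := p) φ).asModule where
  carrier := {x | Additive.toMul (x : Additive V) ∈ N}
  add_mem' := fun hx hy => N.mul_mem hx hy
  zero_mem' := N.one_mem
  smul_mem' := by
    intro a x hx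
    induction a using MonoidAlgebra.induction_linear with
    | zero => rw [zero_smul]; exact N.one_mem
    | add a b ha hb => rw [add_smul]; exact N.mul_mem ha hb
    | single h t =>
      rw [Representation.single_smul]
      exact ((AddSubgroup.toZModSubmodule p) (Subgroup.toAddSubgroup N)).smul_mem t (hN h _ hx)

theorem elemAbVec_smul (h : H) (v : V) :
    MonoidAlgebra.of (ZMod p) H h • elemAbVec p φ v = elemAbVec p φ (φ h v) := by
  rw [MonoidAlgebra.of_apply, Representation.single_smul, one_smul]
  rfl

theorem SemidirectProduct.eq_inl_left {φ : H →* MulAut V} {g : V ⋊[φ] H} (hg : g.right = 1) :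
    g = inl g.left := by
  ext
  · rfl
  · exact hg

variable {φ}

theorem hasInvariantComplements_of_isCGroup [Finite V] (h : IsCGroup p d (V ⋊[φ] H)) :
    HasInvariantComplements (ZMod p) (ZMod p)[H] (elemAbRep (p := p) φ).asModule d := by
  intro X hX
  let Y : Subgroup V := elemAbSubgroup φ X
  have hY : Nat.card (Y.map (inl : V →* V ⋊[φ] H)) = p ^ d := by
    rw [← Nat.card_congr (Y.equivMapOfInjective _ inl_injective).toEquiv, ← hX]
    have := Module.natCard_eq_pow_finrank (K := ZMod p) (V := X)
    rwa [Nat.card_zmod] at this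
  obtain ⟨K, hYK, hK⟩ := h _ hY
  have hfac : ∀ g : V ⋊[φ] H, ∃ y ∈ Y, (inl y)⁻¹ * g ∈ K := by
    intro g
    obtain ⟨_, ⟨y, hy, rfl⟩, k, hk, hg⟩ := Set.mem_mul.1 (hYK ▸ Set.mem_univ g)
    exact ⟨y, hy, by rwa [← hg, inv_mul_cancel_left]⟩
  refine ⟨invariantSubmodule φ (K.comap inl) fun g v hv => ?_, ?_, ?_⟩
  -- The element `y⁻¹ g` of `K` acts on `V` as `g` does, since `V` is abelian; hence `K ∩ V` is
  -- invariant.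
  · obtain ⟨y, hy, hk⟩ := hfac (inr g)
    have := K.mul_mem (K.mul_mem hk hv) (K.inv_mem hk)
    rw [Subgroup.mem_comap]
    convert this using 1
    ext
    · simp
    · simp
  · rw [Submodule.disjoint_def]
    intro v hvX hvK
    have : (inl (Additive.toMul (v : Additive V)) : V ⋊[φ] H) ∈ Y.map inl ⊓ K :=
      ⟨⟨_, hvX, rfl⟩, hvK⟩
    rw [hK, Subgroup.mem_bot] at this
    have hv : Additive.toMul (v : Additive V) = 1 :=
      inl_injective (this.trans (map_one (inl : V →* V ⋊[φ] H)).symm)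
    exact hv
  · rw [codisjoint_iff, eq_top_iff]
    rintro (v : Additive V) -
    obtain ⟨y, hy, hk⟩ := hfac (inl v.toMul)
    refine Submodule.mem_sup.2 ⟨Additive.ofMul y, hy, Additive.ofMul (y⁻¹ * v.toMul), ?_, ?_⟩
    · change inl (y⁻¹ * v.toMul) ∈ K
      rwa [map_mul, map_inv]
    · exact mul_inv_cancel_left y v.toMul

theorem isCGroup_of_hasInvariantComplements [Finite H] (hH : ¬ p ∣ Nat.card H)
    (h : HasInvariantComplements (ZMod p) (ZMod p)[H] (elemAbRep (p := p) φ).asModule d) :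
    IsCGroup p d (V ⋊[φ] H) := by
  intro X hX
  have hpp : p.Prime := Fact.out
  have hright : ∀ g ∈ X, g = inl g.left := by
    intro g hg
    refine eq_inl_left (orderOf_eq_one_iff.1 ?_)
    have h1 : orderOf g.right ∣ p ^ d := by
      refine (orderOf_map_dvd (rightHom : V ⋊[φ] H →* H) g).trans ?_
      rw [← hX, ← Subgroup.orderOf_mk g hg]
      exact orderOf_dvd_natCard _
    have h2 : orderOf g.right ∣ Nat.card H := orderOf_dvd_natCard _
    exact Nat.eq_one_of_dvd_coprimes
      (Nat.Coprime.pow_left d ((Nat.Prime.coprime_iff_not_dvd hpp).2 hH)) h1 h2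
  let Y : Subgroup V := X.comap inl
  have hY : Y.map inl = X := by
    refine le_antisymm (Subgroup.map_comap_le _ _) fun g hg => ⟨g.left, ?_, (hright g hg).symm⟩
    change inl g.left ∈ X
    rwa [← hright g hg]
  have hYc : Nat.card Y = p ^ d := by
    rw [← hX, ← hY]
    exact Nat.card_congr (Y.equivMapOfInjective _ inl_injective).toEquiv
  let Z : Submodule (ZMod p) (elemAbRep (p := p) φ).asModule :=
    AddSubgroup.toZModSubmodule (M := (elemAbRep (p := p) φ).asModule) p
      (show AddSubgroup (Additive V) from Subgroup.toAddSubgroup Y)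
  have hfinZ : Finite Z := Nat.finite_of_card_ne_zero (by
    rw [show Nat.card Z = p ^ d from hYc]; exact pow_ne_zero _ hpp.ne_zero)
  have hZ : finrank (ZMod p) Z = d := by
    have h1 := Module.natCard_eq_pow_finrank (K := ZMod p) (V := Z)
    rw [Nat.card_zmod, show Nat.card Z = p ^ d from hYc] at h1
    exact (Nat.pow_right_injective hpp.two_le h1).symm
  obtain ⟨W, hW⟩ := h Z hZ
  have hinv : ∀ g : H, ∀ v : V, elemAbVec p φ v ∈ W → elemAbVec p φ (φ g v) ∈ W := by
    intro g v hv
    have := W.smul_mem (MonoidAlgebra.of (ZMod p) H g) hv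
    rwa [elemAbVec_smul] at this
  -- This is `W ⋊ H`.
  let K : Subgroup (V ⋊[φ] H) :=
    { carrier := {g | elemAbVec p φ g.left ∈ W}
      mul_mem' := fun {a b} ha hb => W.add_mem ha (hinv a.right b.left hb)
      one_mem' := W.zero_mem
      inv_mem' := fun {a} ha => hinv _ _ (W.neg_mem ha) }
  refine ⟨K, Set.eq_univ_of_forall fun g => ?_, ?_⟩
  · have hg : elemAbVec p φ g.left ∈ Z ⊔ W.restrictScalars (ZMod p) := by
      rw [hW.sup_eq_top]; exact Submodule.mem_top
    obtain ⟨y, hy, w, hw, hyw⟩ := Submodule.mem_sup.1 hg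
    refine Set.mem_mul.2 ⟨inl (Additive.toMul (y : Additive V)), hy,
      ⟨Additive.toMul (w : Additive V), g.right⟩, hw, ?_⟩
    ext
    · rw [mul_left]
      simp only [left_inl, right_inl, map_one, MulAut.one_apply]
      exact hyw
    · simp
  · refine (Subgroup.eq_bot_iff_forall _).2 fun g hg => ?_
    have hgY : g.left ∈ Y := by
      change inl g.left ∈ X
      rw [← hright g hg.1]
      exact hg.1
    have h0 : elemAbVec p φ g.left = 0 :=
      Submodule.disjoint_def.1 hW.disjoint _ hgY hg.2
    rw [hright g hg.1, show g.left = 1 from h0, map_one]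

/-! ### Supersolvability and one-dimensional simple submodules -/

theorem finrank_eq_one_of_isSupersolvable [Finite V] (h : IsSupersolvable (V ⋊[φ] H))
    (S : Submodule (ZMod p)[H] (elemAbRep (p := p) φ).asModule) [IsSimpleModule (ZMod p)[H] S] :
    finrank (ZMod p) S = 1 := by
  classical
  obtain ⟨k, N, hN, h0, hk, hle, hcyc⟩ := h
  let T : Subgroup V := elemAbSubgroup φ (S.restrictScalars (ZMod p))
  let f : T →* V ⋊[φ] H := inl.comp T.subtype
  have hf : Function.Injective f := inl_injective.comp T.subtype_injective
  have hex : ∃ i, ∀ s, f s ∈ N i := ⟨k, fun s => hk ▸ Subgroup.mem_top _⟩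
  have hpos := Submodule.finrank_pos_of_isSimpleModule (ZMod p) S
  have hnt := IsSimpleModule.nontrivial (ZMod p)[H] S
  have hfind : Nat.find hex ≠ 0 := by
    intro hz
    have h1 := Nat.find_spec hex
    rw [hz, h0] at h1
    obtain ⟨s, hs⟩ := exists_ne (0 : S)
    have h2 : (⟨_, s.2⟩ : T) = 1 := hf ((Subgroup.mem_bot.1 (h1 ⟨_, s.2⟩)).trans (map_one f).symm)
    exact hs (Subtype.ext (congrArg Subtype.val h2))
  obtain ⟨i, hi⟩ := Nat.exists_eq_succ_of_ne_zero hfind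
  have hik : i < k := by
    have := Nat.find_min' hex (fun s => hk ▸ Subgroup.mem_top _ : ∀ s, f s ∈ N k)
    omega
  have hnot : ¬ ∀ s, f s ∈ N i := Nat.find_min hex (by omega)
  have hin : ∀ s, f s ∈ N (i + 1) := by
    have := Nat.find_spec hex
    rwa [hi] at this
  have hNi := hN i
  let W : Submodule (ZMod p)[H] (elemAbRep (p := p) φ).asModule :=
    invariantSubmodule φ ((N i).comap inl) fun g v hv => by
      rw [Subgroup.mem_comap, inl_aut, map_inv]
      exact hNi.conj_mem _ hv _
  -- Let `N (i + 1)` be the first term containing `S`. By simplicity `S` meets `N i` trivially, so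
  -- it embeds in a cyclic factor.
  have hdis : Disjoint S W := by
    by_contra hc
    have hat : IsAtom S := isSimpleModule_iff_isAtom.1 inferInstance
    exact hnot fun s => hat.not_disjoint_iff_le.1 hc s.2
  let g : T →* (N (i + 1)).map (QuotientGroup.mk' (N i)) :=
    ((QuotientGroup.mk' (N i)).comp f).codRestrict _ fun s => ⟨f s, hin s, rfl⟩
  have hg : Function.Injective g := by
    refine (injective_iff_map_eq_one g).2 fun s hs => ?_
    have h1 : (QuotientGroup.mk' (N i)) (f s) = 1 := congrArg Subtype.val hs
    have h2 : f s ∈ N i := (QuotientGroup.eq_one_iff _).1 h1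
    exact Subtype.ext (Submodule.disjoint_def.1 hdis _ s.2 h2)
  have hci := hcyc i hik
  have hS : IsCyclic T := isCyclic_of_injective g hg
  obtain ⟨s, hs⟩ := hS.exists_generator
  refine le_antisymm (finrank_le_one (⟨_, s.2⟩ : S) fun w => ?_) hpos
  obtain ⟨n, hn⟩ := Subgroup.mem_zpowers_iff.1 (hs ⟨_, w.2⟩)
  refine ⟨(n : ZMod p), ?_⟩
  exact (Int.cast_smul_eq_zsmul (ZMod p) n (⟨_, s.2⟩ : S)).trans
    (Subtype.ext (congrArg Subtype.val hn))

/-- The subgroup `M` is the end of a finite series of normal subgroups of the whole group, starting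
at the trivial subgroup, with cyclic factors. -/
def HasCyclicSeries {G : Type*} [Group G] (M : Subgroup G) : Prop :=
  ∃ (k : ℕ) (N : ℕ → Subgroup G) (_ : ∀ i, (N i).Normal),
    N 0 = ⊥ ∧ N k = M ∧ (∀ i < k, N i ≤ N (i + 1)) ∧
      ∀ i < k, IsCyclic ((N (i + 1)).map (QuotientGroup.mk' (N i)))

theorem HasCyclicSeries.sup {G : Type*} [Group G] {M P : Subgroup G} (hM : HasCyclicSeries M)
    [IsCyclic P] (hn : (M ⊔ P).Normal) : HasCyclicSeries (M ⊔ P) := by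
  obtain ⟨k, N, hN, h0, rfl, hle, hcyc⟩ := hM
  have hcycP : ∀ (Q : Subgroup G) (hQ : Q.Normal), IsCyclic ((Q ⊔ P).map (QuotientGroup.mk' Q)) := by
    intro Q hQ
    have h1 : Q.map (QuotientGroup.mk' Q) = ⊥ :=
      (Subgroup.map_eq_bot_iff _).2 (QuotientGroup.ker_mk' Q).ge
    rw [Subgroup.map_sup, h1, bot_sup_eq]
    exact isCyclic_of_surjective ((QuotientGroup.mk' Q).subgroupMap P)
      ((QuotientGroup.mk' Q).subgroupMap_surjective P)
  have hnorm : ∀ i, (if i ≤ k then N i else N k ⊔ P).Normal := by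
    intro i
    split_ifs
    · exact hN i
    · exact hn
  refine ⟨k + 1, fun i => if i ≤ k then N i else N k ⊔ P, hnorm, ?_, ?_, ?_, ?_⟩
  · simpa using h0
  · simp
  · intro i hi
    rcases Nat.lt_succ_iff_lt_or_eq.1 hi with hlt | rfl
    · simpa [hlt.le, Nat.succ_le_of_lt hlt] using hle i hlt
    · simp
  · intro i hi
    have key : ∀ (Q R : Subgroup G) (hQ : Q.Normal) (Q' R' : Subgroup G) (hQ' : Q'.Normal),
        Q = Q' → R = R' → IsCyclic (R'.map (QuotientGroup.mk' Q')) →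
          IsCyclic (R.map (QuotientGroup.mk' Q)) := by
      rintro Q R hQ _ _ hQ' rfl rfl h
      exact h
    rcases Nat.lt_succ_iff_lt_or_eq.1 hi with hlt | rfl
    · exact key _ _ (hnorm i) (N i) (N (i + 1)) (hN i) (if_pos hlt.le)
        (if_pos (Nat.succ_le_of_lt hlt)) (hcyc i hlt)
    · exact key _ _ (hnorm i) (N i) (N i ⊔ P) (hN i) (if_pos le_rfl) (if_neg (by omega))
        (hcycP _ _)

/-- A maximal `M` with a cyclic series absorbs every invariant line, hence `V`. As `H` is abelian,
`G / M` is then abelian, so `M` absorbs every cyclic subgroup too. -/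
theorem isSupersolvable_of_finrank_eq_one [Finite V] [Finite H]
    [IsSemisimpleModule (ZMod p)[H] (elemAbRep (p := p) φ).asModule]
    (hφ : Function.Injective φ)
    (h1 : ∀ S : Submodule (ZMod p)[H] (elemAbRep (p := p) φ).asModule,
      IsSimpleModule (ZMod p)[H] S → finrank (ZMod p) S = 1) :
    IsSupersolvable (V ⋊[φ] H) := by
  -- Elements of `H` act by scalars on each simple submodule, so their actions commute on `V`;
  -- faithfulness concludes.
  have hcommH : ∀ a b : H, a * b = b * a := by
    intro a b
    apply hφ
    ext v
    let P : AddSubgroup (elemAbRep (p := p) φ).asModule :=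
      { carrier := {x | MonoidAlgebra.of (ZMod p) H (a * b) • x =
          MonoidAlgebra.of (ZMod p) H (b * a) • x}
        add_mem' := fun {x y} hx hy => by
          rw [Set.mem_ofPred_eq] at *
          rw [smul_add, smul_add, hx, hy]
        zero_mem' := by
          rw [Set.mem_ofPred_eq, smul_zero, smul_zero]
        neg_mem' := fun {x} hx => by
          rw [Set.mem_ofPred_eq] at *
          rw [smul_neg, smul_neg, hx] }
    have hP : elemAbVec p φ v ∈ P := by
      refine Submodule.mem_of_forall_isSimpleModule (A := (ZMod p)[H]) P (fun S hS x hx => ?_) _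
      by_cases hx0 : (⟨x, hx⟩ : S) = 0
      · rw [show x = 0 from congrArg Subtype.val hx0]
        exact P.zero_mem
      have hsc : ∀ g : H, ∃ c : ZMod p, MonoidAlgebra.of (ZMod p) H g • x = c • x := by
        intro g
        obtain ⟨c, hc⟩ := (finrank_eq_one_iff_of_nonzero' _ hx0).1 (h1 S hS)
          ⟨MonoidAlgebra.of (ZMod p) H g • x, S.smul_mem _ hx⟩
        exact ⟨c, (congrArg Subtype.val hc).symm⟩
      obtain ⟨α, hα⟩ := hsc a
      obtain ⟨β, hβ⟩ := hsc b
      change MonoidAlgebra.of (ZMod p) H (a * b) • x = MonoidAlgebra.of (ZMod p) H (b * a) • x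
      rw [map_mul, map_mul, mul_smul, mul_smul, hα, hβ,
        smul_comm (MonoidAlgebra.of (ZMod p) H a) β x, hα,
        smul_comm (MonoidAlgebra.of (ZMod p) H b) α x, hβ, smul_comm]
    have hP' : MonoidAlgebra.of (ZMod p) H (a * b) • elemAbVec p φ v =
        MonoidAlgebra.of (ZMod p) H (b * a) • elemAbVec p φ v := hP
    rw [elemAbVec_smul, elemAbVec_smul] at hP'
    exact hP'
  have hfinG : Finite (V ⋊[φ] H) := Finite.of_equiv _ equivProd.symm
  obtain ⟨M, hM, hmax⟩ := (wellFounded_gt (α := Subgroup (V ⋊[φ] H))).has_min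
    {M | HasCyclicSeries M} ⟨⊥, 0, fun _ => ⊥, fun _ => inferInstance, rfl, rfl,
      fun i hi => absurd hi (Nat.not_lt_zero i), fun i hi => absurd hi (Nat.not_lt_zero i)⟩
  have hMn : M.Normal := by
    obtain ⟨k, N, hN, -, rfl, -, -⟩ := hM
    exact hN k
  have hMle : ∀ P : Subgroup (V ⋊[φ] H), IsCyclic P → (M ⊔ P).Normal → P ≤ M := by
    intro P hP hn
    by_contra hc
    exact hmax _ (hM.sup hn) (left_lt_sup.2 hc)
  have hV : ∀ v : V, inl v ∈ M := by
    let Q : AddSubgroup (elemAbRep (p := p) φ).asModule :=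
      show AddSubgroup (Additive V) from Subgroup.toAddSubgroup (M.comap inl)
    intro v
    refine Submodule.mem_of_forall_isSimpleModule (A := (ZMod p)[H]) Q (fun S hS x hx => ?_)
      (elemAbVec p φ v)
    let T : Subgroup V := elemAbSubgroup φ (S.restrictScalars (ZMod p))
    have hT : IsCyclic T := by
      have hc : Nat.card S = p := by
        rw [Module.natCard_eq_pow_finrank (K := ZMod p) (V := S), Nat.card_zmod, h1 S hS, pow_one]
      exact isCyclic_of_prime_card (p := p) hc
    have hcr : IsCyclic (T.map (inl : V →* V ⋊[φ] H)) :=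
      isCyclic_of_surjective _ (MonoidHom.subgroupMap_surjective inl T)
    have hfn : (T.map (inl : V →* V ⋊[φ] H)).Normal := by
      refine ⟨?_⟩
      rintro _ ⟨s, hs, rfl⟩ g
      refine ⟨φ g.right s, ?_, ?_⟩
      · have h2 : elemAbVec p φ s ∈ S := hs
        have := S.smul_mem (MonoidAlgebra.of (ZMod p) H g.right) h2
        rw [elemAbVec_smul] at this
        exact this
      · ext
        · simp [mul_comm]
        · simp
    exact hMle _ hcr inferInstance ⟨x, hx, rfl⟩
  have hG : M = ⊤ := by
    refine eq_top_iff.2 fun g _ => ?_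
    refine hMle (Subgroup.zpowers g) inferInstance ⟨fun m hm x => ?_⟩ (Subgroup.mem_zpowers g)
    have hc : x * m * x⁻¹ * m⁻¹ ∈ M := by
      rw [eq_inl_left (g := x * m * x⁻¹ * m⁻¹) (by simp [hcommH x.right m.right])]
      exact hV _
    have := (M ⊔ Subgroup.zpowers g).mul_mem (Subgroup.mem_sup_left hc) hm
    rwa [inv_mul_cancel_right] at this
  rw [hG] at hM
  exact hM

end SemidirectProduct

/-! ### Assembling the equivalence -/

section Classification

open Module

variable {p d n : ℕ} [Fact p.Prime] {H V : Type*} [Group H] [CommGroup V]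

theorem isCyclic_of_hasInvariantComplements [Module (ZMod p) (Additive V)] {φ : H →* MulAut V}
    [Finite H] [Finite V]
    [IsSemisimpleModule (ZMod p)[H] (elemAbRep (p := p) φ).asModule]
    (hφ : Function.Injective φ) (hd : 0 < d)
    (hdn : d < finrank (ZMod p) (elemAbRep (p := p) φ).asModule)
    (h : HasInvariantComplements (ZMod p) (ZMod p)[H] (elemAbRep (p := p) φ).asModule d)
    (S : Submodule (ZMod p)[H] (elemAbRep (p := p) φ).asModule) [IsSimpleModule (ZMod p)[H] S]
    (hS : 1 < finrank (ZMod p) S) : IsCyclic H := by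
  refine isCyclic_of_forall_exists_end_apply_eq (M := S) (MonoidAlgebra.of (ZMod p) H)
    (h.exists_end_apply_eq hd hdn S hS) fun g hg => hφ ?_
  let P : AddSubgroup (elemAbRep (p := p) φ).asModule :=
    { carrier := {x | MonoidAlgebra.of (ZMod p) H g • x = x}
      add_mem' := fun {x y} hx hy => by
        rw [Set.mem_ofPred_eq] at *
        rw [smul_add, hx, hy]
      zero_mem' := smul_zero _
      neg_mem' := fun {x} hx => by
        rw [Set.mem_ofPred_eq] at *
        rw [smul_neg, hx] }
  ext v
  have hP : MonoidAlgebra.of (ZMod p) H g • elemAbVec p φ v = elemAbVec p φ v := by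
    refine Submodule.mem_of_forall_isSimpleModule (A := (ZMod p)[H]) P
      (fun T hT x hx => ?_) (elemAbVec p φ v)
    obtain ⟨f⟩ := h.nonempty_linearEquiv hd hdn S T hS
    have h1 : MonoidAlgebra.of (ZMod p) H g • (⟨x, hx⟩ : T) = ⟨x, hx⟩ := by
      rw [← f.apply_symm_apply ⟨x, hx⟩, ← map_smul, hg]
    exact congrArg Subtype.val h1
  rw [elemAbVec_smul] at hP
  rw [map_one]
  exact hP

theorem isCGroup_iff_isSupersolvable_or_isCyclic [Module (ZMod p) (Additive V)]
    {φ : H →* MulAut V} [Finite H] (hH : ¬ p ∣ Nat.card H) (hVn : Nat.card V = p ^ n)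
    (hφ : Function.Injective φ) (hd : 0 < d) (hdn : d < n) :
    IsCGroup p d (V ⋊[φ] H) ↔ (IsSupersolvable (V ⋊[φ] H) ∨
      (IsCyclic H ∧ ∃ e : ℕ, 1 < e ∧ e ∣ Nat.gcd d n ∧
        IsHomogeneousOfDim (elemAbRep (p := p) φ) e)) := by
  have hpp : p.Prime := Fact.out
  have hfV : Finite V := Nat.finite_of_card_ne_zero (hVn ▸ pow_ne_zero n hpp.ne_zero)
  -- The instance that lets Maschke's theorem supply semisimplicity.
  have hne : NeZero (Nat.card H : ZMod p) := ⟨by rwa [Ne, ZMod.natCast_eq_zero_iff]⟩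
  have hss : IsSemisimpleModule (ZMod p)[H] (elemAbRep (p := p) φ).asModule := inferInstance
  have hn : finrank (ZMod p) (elemAbRep (p := p) φ).asModule = n := by
    have h1 := Module.natCard_eq_pow_finrank (K := ZMod p) (V := (elemAbRep (p := p) φ).asModule)
    rw [Nat.card_zmod] at h1
    exact (Nat.pow_right_injective hpp.two_le (hVn.symm.trans h1)).symm
  constructor
  · intro h
    have hC := hasInvariantComplements_of_isCGroup h
    have hdn' : d < finrank (ZMod p) (elemAbRep (p := p) φ).asModule := by rwa [hn]
    have hnt : Nontrivial (elemAbRep (p := p) φ).asModule :=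
      Module.nontrivial_of_finrank_pos (R := ZMod p) (by omega)
    obtain ⟨S, hS⟩ := IsSemisimpleModule.exists_simple_submodule (ZMod p)[H]
      (elemAbRep (p := p) φ).asModule
    have hdim : ∀ T : Submodule (ZMod p)[H] (elemAbRep (p := p) φ).asModule,
        IsSimpleModule (ZMod p)[H] T → finrank (ZMod p) T = finrank (ZMod p) S :=
      fun T _ => hC.finrank_eq hd hdn' T S
    have hpos := Submodule.finrank_pos_of_isSimpleModule (ZMod p) S
    rcases Nat.lt_or_ge 1 (finrank (ZMod p) S) with h1 | h1
    · refine Or.inr ⟨isCyclic_of_hasInvariantComplements hφ hd hdn' hC S h1,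
        finrank (ZMod p) S, h1, Nat.dvd_gcd (hC.dvd hd hdn' S) ?_, hss, ?_, hdim⟩
      · have := Submodule.dvd_finrank_of_forall_isSimpleModule hdim ⊤
        rwa [show finrank (ZMod p) (⊤ : Submodule (ZMod p)[H] (elemAbRep (p := p) φ).asModule) = n
          from (finrank_top (ZMod p) (elemAbRep (p := p) φ).asModule).trans hn] at this
      · intro T hT T' hT'
        exact hC.nonempty_linearEquiv hd hdn' T' T ((hdim T' hT').symm ▸ h1)
    · exact Or.inl (isSupersolvable_of_finrank_eq_one hφ fun T hT => by
        rw [hdim T hT]; omega)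
  · rintro (h | ⟨hcyc, e, -, hed, -, hiso, hdim⟩)
    · exact isCGroup_of_hasInvariantComplements hH
        (hasInvariantComplements_of_finrank_eq_one
          (fun S hS => finrank_eq_one_of_isSupersolvable h S) d)
    · refine isCGroup_of_hasInvariantComplements hH
        (hasInvariantComplements_of_isIsotypic (fun a b => ?_) hiso hdim
          (hed.trans (Nat.gcd_dvd_left d n)))
      let _ : CommGroup H := IsCyclic.commGroup
      exact mul_comm a b

end Classification

theorem theoremB {p d n : ℕ} [Fact p.Prime] {H V : Type*} [Group H] [Finite H] [CommGroup V]
    (hH : ¬ p ∣ Nat.card H) (hV : ∀ v : V, v ^ p = 1) (hVn : Nat.card V = p ^ n)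
    (φ : H →* MulAut V) (hφ : Function.Injective φ) (hd : 0 < d) (hdn : d < n) :
    IsNontrivialCGroup p d (V ⋊[φ] H) ↔
      (IsSupersolvable (V ⋊[φ] H) ∨
        (IsCyclic H ∧ ∃ e : ℕ, 1 < e ∧ e ∣ Nat.gcd d n ∧
          letI : Module (ZMod p) (Additive V) := elemAbModule hV
          IsHomogeneousOfDim (elemAbRep (p := p) φ) e)) := by
  have hpp : p.Prime := Fact.out
  let _ : Module (ZMod p) (Additive V) := elemAbModule hV
  have hcard : p ^ d ≤ p ^ (Nat.card (V ⋊[φ] H)).factorization p := by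
    refine Nat.pow_le_pow_right hpp.pos (hdn.le.trans ?_)
    have h0 : Nat.card (V ⋊[φ] H) ≠ 0 := by
      rw [SemidirectProduct.card, hVn]
      exact mul_ne_zero (pow_ne_zero n hpp.ne_zero) Nat.card_pos.ne'
    rw [← hpp.pow_dvd_iff_le_factorization h0, SemidirectProduct.card, hVn]
    exact dvd_mul_right _ _
  exact (and_iff_left hcard).trans (isCGroup_iff_isSupersolvable_or_isCyclic hH hVn hφ hd hdn)
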